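/- Let $B$ be a connected locally finite poset (every element has only finitely many elements below it), regarded as a topological space whose open sets are the lower sets, and let $G$ be a group. Write $x\prec y$ if $y$ covers $x$ in $B$. An edge-path from $x$ to $y$ is a finite (possibly empty) sequence of consecutive edges of the Hasse diagram of $B$ leading from $x$ to $y$, each traversed upwards or downwards; it is monotonic if all its edges are traversed upwards, or all downwards. A $G$-coloring $c$ of $B$ assigns an element $c(x,y)\in G$ to every pair $x\prec y$; put $c(y,x)=c(x,y)^{-1}$. The weight of an edge-path $(x_0,x_1)(x_1,x_2)\cdots(x_{n-1},x_n)$ is $c(x_0,x_1)c(x_1,x_2)\cdots c(x_{n-1},x_n)$, and the weight of the empty edge-path is $1$. The coloring $c$ is admissible if for all $x\le y$ any two monotonic edge-paths from $x$ to $y$ have the same weight; it is connected if every $g\in G$ is the weight of a closed edge-path at a base point $x_0\in B$ (the choice of $x_0$ is irrelevant). Two $G$-colorings $c,c'$ are equivalent if there are an automorphism $\varphi$ of $G$ and elements $g_x\in G$ $(x\in B)$ such that $c'(x,y)=\varphi(g_x\,c(x,y)\,g_y^{-1})$ whenever $x\prec y$. Let $E(c)$ be the set $B\times G$ with the partial order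 generated by the relations $(x,g)\prec(y,g\,c(x,y))$ for $x\prec y$ in $B$, with the topology of lower sets, and let $p(c)\colon E(c)\to B$ be the projection $(x,g)\mapsto x$. A covering $p\colon E\to B$ is regular if $E$ is connected and its group $\operatorname{Deck}(p)$ of deck transformations acts transitively on each fiber; coverings $p\colon E\to B$ and $p'\colon E'\to B$ are equivalent if there is a homeomorphism $h\colon E\to E'$ with $p'h=p$. If $c$ is an admissible connected $G$-coloring of $B$, then $p(c)\colon E(c)\to B$ is a regular covering of $B$ with $\operatorname{Deck}(p(c))\cong G$. If $c$ and $c'$ are equivalent admissible connected $G$-colorings of $B$, then $p(c)$ and $p(c')$ are equivalent coverings of $B$. The induced map $[c]\mapsto[p(c)]$ is a bijection from the set of equivalence classes of admissible connected $G$-colorings of $B$ onto the set of equivalence classes of regular coverings $p\colon E\to B$ with $\operatorname{Deck}(p)\cong G$. -/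

import Mathlib

universe u v w

namespace PosetColoring

section Colorings

variable {B : Type u} [PartialOrder B] {G : Type v} [Group G]

/-- A poset is locally finite if every element has only finitely many elements below it. -/
def LocallyFinitePoset (B : Type u) [PartialOrder B] : Prop :=
  ∀ x : B, (Set.Iic x).Finite

/-- Edge-paths in the Hasse diagram of `B`; an edge `x ⋖ y` may be traversed upwards (from `x`
to `y`) or downwards (from `y` to `x`). -/
inductive EdgePath : B → B → Type u
  | nil (x : B) : EdgePath x x
  | up {x y z : B} (h : x ⋖ y) (ξ : EdgePath y z) : EdgePath x z
  | down {x y z : B} (h : y ⋖ x) (ξ : EdgePath y z) : EdgePath x z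

/-- All edges of the path are traversed upwards. -/
def EdgePath.IsAscending : ∀ {x y : B}, EdgePath x y → Prop
  | _, _, .nil _ => True
  | _, _, .up _ ξ => ξ.IsAscending
  | _, _, .down _ _ => False

/-- All edges of the path are traversed downwards. -/
def EdgePath.IsDescending : ∀ {x y : B}, EdgePath x y → Prop
  | _, _, .nil _ => True
  | _, _, .up _ _ => False
  | _, _, .down _ ξ => ξ.IsDescending

/-- An edge-path is monotonic if it is ascending or descending. -/
def EdgePath.IsMonotonic {x y : B} (ξ : EdgePath x y) : Prop :=
  ξ.IsAscending ∨ ξ.IsDescending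

/-- A `G`-coloring of `B`: an element of `G` for each edge `x ⋖ y` of the Hasse diagram. -/
abbrev Coloring (B : Type u) [PartialOrder B] (G : Type v) : Type (max u v) :=
  ∀ x y : B, x ⋖ y → G

/-- The weight of an edge-path: the ordered product of the colors of its edges, where an edge
traversed downwards contributes the inverse of its color. -/
def weight (c : Coloring B G) : ∀ {x y : B}, EdgePath x y → G
  | _, _, .nil _ => 1
  | x, _, .up (y := y) h ξ => c x y h * weight c ξ
  | x, _, .down (y := y) h ξ => (c y x h)⁻¹ * weight c ξ

/-- Any two monotonic edge-paths from `x` to `y`, where `x ≤ y`, have the same weight. -/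
def Admissible (c : Coloring B G) : Prop :=
  ∀ x y : B, x ≤ y → ∀ ξ ξ' : EdgePath x y, ξ.IsMonotonic → ξ'.IsMonotonic →
    weight c ξ = weight c ξ'

/-- Every element of `G` is the weight of a closed edge-path at the base point. On a connected
poset this does not depend on the base point, so we ask for it at every point. -/
def ConnectedColoring (c : Coloring B G) : Prop :=
  ∀ (x₀ : B) (g : G), ∃ ξ : EdgePath x₀ x₀, weight c ξ = g

/-- Equivalence of colorings. -/
def ColoringEquiv (c c' : Coloring B G) : Prop :=
  ∃ (φ : G ≃* G) (g : B → G), ∀ (x y : B) (h : x ⋖ y), c' x y h = φ (g x * c x y h * (g y)⁻¹)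

theorem ColoringEquiv.refl (c : Coloring B G) : ColoringEquiv c c :=
  ⟨MulEquiv.refl G, fun _ => 1, by simp⟩

theorem ColoringEquiv.symm {c c' : Coloring B G} (h : ColoringEquiv c c') :
    ColoringEquiv c' c := by
  obtain ⟨φ, g, h⟩ := h
  refine ⟨φ.symm, fun x => φ (g x)⁻¹, fun x y hxy => ?_⟩
  simp [h, mul_assoc]

theorem ColoringEquiv.trans {c c' c'' : Coloring B G} (h : ColoringEquiv c c')
    (h' : ColoringEquiv c' c'') : ColoringEquiv c c'' := by
  obtain ⟨φ, g, h⟩ := h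
  obtain ⟨ψ, k, h'⟩ := h'
  refine ⟨φ.trans ψ, fun x => φ.symm (k x) * g x, fun x y hxy => ?_⟩
  simp [h, h', mul_assoc]

/-- The admissible connected `G`-colorings of `B`. -/
def ACColoring (B : Type u) [PartialOrder B] (G : Type v) [Group G] : Type (max u v) :=
  {c : Coloring B G // Admissible c ∧ ConnectedColoring c}

instance ACColoring.setoid : Setoid (ACColoring B G) where
  r c c' := ColoringEquiv c.1 c'.1
  iseqv := ⟨fun c => ColoringEquiv.refl c.1, ColoringEquiv.symm, ColoringEquiv.trans⟩

/-- The underlying set `B × G` of the poset `E(c)`. -/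
@[ext]
structure ColorSpace (c : Coloring B G) : Type (max u v) where
  base : B
  elt : G

/-- The generating relations `(x, g) ≺ (y, g · c(x, y))` for `x ⋖ y`. -/
def ColorSpace.Step {c : Coloring B G} (a b : ColorSpace c) : Prop :=
  ∃ h : a.base ⋖ b.base, b.elt = a.elt * c a.base b.base h

theorem ColorSpace.base_le {c : Coloring B G} {a b : ColorSpace c}
    (h : Relation.ReflTransGen ColorSpace.Step a b) : a.base ≤ b.base := by
  induction h with
  | refl => exact le_rfl
  | tail _ h ih => exact ih.trans h.1.le

theorem ColorSpace.eq_of_base_le {c : Coloring B G} {a b : ColorSpace c}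
    (h : Relation.ReflTransGen ColorSpace.Step a b) (h' : b.base ≤ a.base) : a = b := by
  rcases Relation.ReflTransGen.cases_head h with h | ⟨d, hd, hdb⟩
  · exact h
  · exact absurd (hd.1.lt.trans_le ((ColorSpace.base_le hdb).trans h')) (lt_irrefl _)

/-- The order of `E(c)` is the one generated by `ColorSpace.Step`. -/
instance ColorSpace.partialOrder (c : Coloring B G) : PartialOrder (ColorSpace c) where
  le := Relation.ReflTransGen ColorSpace.Step
  le_refl _ := Relation.ReflTransGen.refl
  le_trans _ _ _ := Relation.ReflTransGen.trans
  le_antisymm _ _ h h' := ColorSpace.eq_of_base_le h (ColorSpace.base_le h')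

/-- The open sets of the poset `E(c)` are its lower sets. -/
instance ColorSpace.topologicalSpace (c : Coloring B G) : TopologicalSpace (ColorSpace c) :=
  Topology.lowerSet (ColorSpace c)

/-- The projection `p(c) : E(c) → B`. -/
def ColorSpace.proj (c : Coloring B G) (a : ColorSpace c) : B := a.base

end Colorings

section Coverings

variable {B : Type u} [TopologicalSpace B]

/-- The group of deck transformations of `p`, under composition. -/
def Deck {E : Type w} [TopologicalSpace E] (p : E → B) : Subgroup (E ≃ₜ E) where
  carrier := {h | ∀ e, p (h e) = p e}
  mul_mem' := by
    intro a b ha hb e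
    exact (ha (b e)).trans (hb e)
  one_mem' := fun _ => rfl
  inv_mem' := by
    intro a ha e
    have h := ha (a.symm e)
    rw [a.apply_symm_apply] at h
    exact h.symm

/-- A regular covering: a surjective covering map with connected total space whose deck
transformation group acts transitively on every fiber. -/
structure IsRegularCovering {E : Type w} [TopologicalSpace E] (p : E → B) : Prop where
  connected : ConnectedSpace E
  isCoveringMap : IsCoveringMap p
  surjective : Function.Surjective p
  transitive : ∀ e e' : E, p e = p e' → ∃ h ∈ Deck p, h e = e'

/-- Two coverings of `B` are equivalent if there is a homeomorphism over `B` between them. -/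
def CoveringEquiv {E : Type v} [TopologicalSpace E] {E' : Type w} [TopologicalSpace E']
    (p : E → B) (p' : E' → B) : Prop :=
  ∃ h : E ≃ₜ E', ∀ e, p' (h e) = p e

/-- The regular coverings of `B` whose deck transformation group is isomorphic to `G`. -/
structure RegularCovering (B : Type u) [TopologicalSpace B] (G : Type v) [Group G] where
  total : Type w
  [top : TopologicalSpace total]
  proj : total → B
  regular : IsRegularCovering proj
  deck : Nonempty (Deck proj ≃* G)

attribute [instance] RegularCovering.top

instance RegularCovering.setoid (G : Type v) [Group G] :
    Setoid (RegularCovering.{u, v, w} B G) where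
  r C C' := CoveringEquiv C.proj C'.proj
  iseqv :=
    { refl := fun C => ⟨Homeomorph.refl C.total, fun _ => rfl⟩
      symm := by
        rintro C C' ⟨h, hh⟩
        refine ⟨h.symm, fun e => ?_⟩
        rw [← hh, h.apply_symm_apply]
      trans := by
        rintro C C' C'' ⟨h, hh⟩ ⟨k, hk⟩
        exact ⟨h.trans k, fun e => (hk (h e)).trans (hh e)⟩ }

end Coverings

/-- The projection `p(c) : E(c) → B` as a regular covering with deck group isomorphic to `G`. -/
def coveringOf {B : Type u} [PartialOrder B] [TopologicalSpace B] {G : Type v} [Group G]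
    (c : Coloring B G)
    (h : IsRegularCovering (ColorSpace.proj c) ∧ Nonempty (Deck (ColorSpace.proj c) ≃* G)) :
    RegularCovering.{u, v, max u v} B G where
  total := ColorSpace c
  proj := ColorSpace.proj c
  regular := h.1
  deck := h.2

end PosetColoring

/-!
A regular covering with deck group `G` is the same thing as a covering by a connected space that is
the quotient map of a free action of `G`. The group acts on `E(c)` by left multiplication, with
quotient `B`; admissibility of `c` makes the quotient map a covering, connectedness of `c` makes
`E(c)` connected.

Conversely, let `p : E → B` be the covering given by an action of `G`, and choose a section `s` of
`p`, in general not continuous. In a space whose open sets are the lower sets, `x ≤ y` means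
`x ⤳ y`, and specializations lift uniquely along coverings, so each edge `x ⋖ y` has a unique color
`g` with `s x ⤳ g • s y`. Then `(x, g) ↦ g • s x` identifies `E(c)` with `E`. Another section, or
another identification of the deck group with `G`, changes `c` exactly by an equivalence of
colorings.
-/

namespace PosetColoring

open scoped Topology

section CovByGenerated

/-- A partial order generated by its covering relation: its Hasse diagram determines it. -/
class IsCovByGenerated (P : Type*) [PartialOrder P] : Prop where
  reflTransGen_covBy_of_le {x y : P} : x ≤ y → Relation.ReflTransGen (· ⋖ ·) x y

variable {P : Type*} [PartialOrder P]

theorem LocallyFinitePoset.isCovByGenerated (hP : LocallyFinitePoset P) : IsCovByGenerated P where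
  reflTransGen_covBy_of_le h := by
    let _ : LocallyFiniteOrder P :=
      LocallyFiniteOrder.ofFiniteIcc fun a b => (hP b).subset Set.Icc_subset_Iic_self
    exact le_iff_reflTransGen_covBy.1 h

variable [IsCovByGenerated P]

theorem EdgePath.exists_isAscending {x y : P} (h : x ≤ y) : ∃ ξ : EdgePath x y, ξ.IsAscending := by
  replace h := IsCovByGenerated.reflTransGen_covBy_of_le h
  induction h using Relation.ReflTransGen.head_induction_on with
  | refl => exact ⟨.nil y, trivial⟩
  | head hab _ ih =>
    obtain ⟨ξ, hξ⟩ := ih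
    exact ⟨.up hab ξ, hξ⟩

variable [TopologicalSpace P] [Topology.IsLowerSet P]

theorem continuous_iff_specializes_of_covBy {X : Type*} [TopologicalSpace X] {f : P → X} :
    Continuous f ↔ ∀ x y, x ⋖ y → f x ⤳ f y := by
  refine ⟨fun hf x y h => (Topology.IsLowerSet.specializes_iff_le.2 h.le).map hf, fun hf => ?_⟩
  have hle : ∀ x y, x ≤ y → f x ⤳ f y := fun x y h => by
    replace h := IsCovByGenerated.reflTransGen_covBy_of_le h
    induction h with
    | refl => exact specializes_rfl
    | tail _ hyz ih => exact ih.trans (hf _ _ hyz)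
  exact continuous_def.2 fun U hU => Topology.IsLowerSet.isOpen_iff_isLowerSet.2
    fun y x h hy => (hle x y h).mem_open hU hy

theorem isClopen_iff_covBy {S : Set P} : IsClopen S ↔ ∀ x y, x ⋖ y → (x ∈ S ↔ y ∈ S) := by
  classical
  rw [← continuous_boolIndicator_iff_isClopen, continuous_iff_specializes_of_covBy]
  simp only [specializes_iff_eq, Set.boolIndicator]
  grind

theorem connectedSpace_iff_edgePath :
    ConnectedSpace P ↔ Nonempty P ∧ ∀ x y : P, Nonempty (EdgePath x y) := by
  refine ⟨fun _ => ⟨inferInstance, fun x y => ?_⟩, fun ⟨_, h⟩ => ?_⟩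
  · have hclopen : IsClopen {x : P | Nonempty (EdgePath x y)} := isClopen_iff_covBy.2
      fun a b hab => ⟨fun ⟨ξ⟩ => ⟨.down hab ξ⟩, fun ⟨ξ⟩ => ⟨.up hab ξ⟩⟩
    exact (hclopen.eq_univ ⟨y, ⟨.nil y⟩⟩).ge (Set.mem_univ x)
  · suffices PreconnectedSpace P from ⟨‹_›⟩
    refine preconnectedSpace_iff_clopen.2 fun S hS => S.eq_empty_or_nonempty.imp id ?_
    rintro ⟨y, hy⟩
    refine Set.eq_univ_of_forall fun x => ?_
    rw [isClopen_iff_covBy] at hS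
    obtain ⟨ξ⟩ := h x y
    induction ξ with
    | nil => exact hy
    | up hab _ ih => exact (hS _ _ hab).2 (ih hy)
    | down hab _ ih => exact (hS _ _ hab).1 (ih hy)

end CovByGenerated

section EdgePaths

variable {B : Type*} [PartialOrder B] {G : Type*} [Group G]

theorem EdgePath.IsDescending.le {x y : B} {ξ : EdgePath x y} (h : ξ.IsDescending) : y ≤ x := by
  induction ξ with
  | nil => exact le_rfl
  | up => exact h.elim
  | down hxy _ ih => exact (ih h).trans hxy.le

theorem EdgePath.IsMonotonic.isAscending {x y : B} {ξ : EdgePath x y} (h : ξ.IsMonotonic)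
    (hxy : x ≤ y) : ξ.IsAscending := by
  rcases h with h | h
  · exact h
  · cases ξ with
    | nil => trivial
    | up => exact h.elim
    | down hlt ξ => exact absurd (hlt.lt.trans_le hxy) (IsDescending.le (ξ := ξ) h).not_gt

/-- Concatenation of edge-paths. -/
def EdgePath.trans : ∀ {x y z : B}, EdgePath x y → EdgePath y z → EdgePath x z
  | _, _, _, .nil _, η => η
  | _, _, _, .up h ξ, η => .up h (ξ.trans η)
  | _, _, _, .down h ξ, η => .down h (ξ.trans η)

theorem weight_trans (c : Coloring B G) {x y z : B} (ξ : EdgePath x y) (η : EdgePath y z) :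
    weight c (ξ.trans η) = weight c ξ * weight c η := by
  induction ξ <;> simp_all [EdgePath.trans, weight, mul_assoc]

end EdgePaths

namespace ColorSpace

variable {B : Type*} [PartialOrder B] {G : Type*} [Group G] {c : Coloring B G}

section Order

variable {a b : ColorSpace c}

theorem Step.le (h : Step a b) : a ≤ b := Relation.ReflTransGen.single h

theorem strictMono_proj (c : Coloring B G) : StrictMono (proj c) := fun _ _ h =>
  lt_of_le_not_ge (base_le h.le) fun h' => h.ne (eq_of_base_le h.le h')

theorem le_iff_step_of_base_covBy (h : a.base ⋖ b.base) : a ≤ b ↔ Step a b := by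
  refine ⟨fun hab => ?_, Step.le⟩
  rcases Relation.ReflTransGen.cases_head hab with rfl | ⟨d, had, hdb⟩
  · exact absurd h.lt (lt_irrefl _)
  · have hbase : d.base = b.base :=
      (base_le hdb).lt_or_eq.resolve_left (h.2 had.1.lt)
    rwa [eq_of_base_le hdb hbase.ge] at had

theorem covBy_iff_step : a ⋖ b ↔ Step a b := by
  refine ⟨fun h => ?_, fun h => ?_⟩
  · rcases Relation.ReflTransGen.cases_head h.le with rfl | ⟨d, had, hdb⟩
    · exact absurd h.lt (lt_irrefl _)
    · have had_lt : a < d := lt_of_le_of_ne had.le fun hne => had.1.ne (congrArg base hne)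
      obtain rfl : d = b := (le_iff_lt_or_eq.1 hdb).resolve_left (h.2 had_lt)
      exact had
  · have hlt : a < b := lt_of_le_of_ne h.le fun hne => h.1.ne (congrArg base hne)
    exact ⟨hlt, fun d had hdb => h.1.2 (strictMono_proj c had) (strictMono_proj c hdb)⟩

instance : IsCovByGenerated (ColorSpace c) where
  reflTransGen_covBy_of_le h := Relation.ReflTransGen.mono (fun _ _ => covBy_iff_step.2) _ _ h

theorem le_of_isAscending {x y : B} {ξ : EdgePath x y} (h : ξ.IsAscending) (g : G) :
    (⟨x, g⟩ : ColorSpace c) ≤ ⟨y, g * weight c ξ⟩ := by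
  induction ξ generalizing g with
  | nil => simp [weight]
  | @up x y z hxy ξ ih =>
    rw [weight, ← mul_assoc]
    exact (Step.le (a := ⟨x, g⟩) (b := ⟨y, g * c x y hxy⟩) ⟨hxy, rfl⟩).trans (ih h _)
  | down => exact h.elim

theorem le_iff : a ≤ b ↔
    ∃ ξ : EdgePath a.base b.base, ξ.IsAscending ∧ b.elt = a.elt * weight c ξ := by
  refine ⟨fun h => ?_, fun ⟨ξ, hξ, h⟩ => ?_⟩
  · replace h : Relation.ReflTransGen Step a b := h
    induction h using Relation.ReflTransGen.head_induction_on with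
    | refl => exact ⟨.nil _, trivial, by simp [weight]⟩
    | head hab _ ih =>
      obtain ⟨ξ, hξ, h⟩ := ih
      obtain ⟨hab, h'⟩ := hab
      exact ⟨.up hab ξ, hξ, by rw [h, h', weight, mul_assoc]⟩
  · exact (le_of_isAscending hξ a.elt).trans_eq (ColorSpace.ext rfl h.symm)

theorem admissible_iff :
    Admissible c ↔ ∀ a b b' : ColorSpace c, a ≤ b → a ≤ b' → b.base = b'.base → b = b' := by
  refine ⟨fun hc a ⟨y, g⟩ ⟨y', g'⟩ h h' hbase => ?_, fun hc x y hxy ξ ξ' hξ hξ' => ?_⟩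
  · obtain rfl : y = y' := hbase
    obtain ⟨ξ, hξ, hg⟩ := le_iff.1 h
    obtain ⟨ξ', hξ', hg'⟩ := le_iff.1 h'
    have hw : weight c ξ = weight c ξ' := hc _ _ (base_le h) ξ ξ' (.inl hξ) (.inl hξ')
    exact ColorSpace.ext rfl (by rw [hg, hg', hw])
  · have heq := hc ⟨x, 1⟩ _ _ (le_of_isAscending (hξ.isAscending hxy) 1)
      (le_of_isAscending (hξ'.isAscending hxy) 1) rfl
    simpa using congrArg elt heq

theorem exists_le_of_le_base [IsCovByGenerated B] {x : B} (h : x ≤ b.base) :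
    ∃ a ≤ b, a.base = x := by
  obtain ⟨ξ, hξ⟩ := EdgePath.exists_isAscending h
  exact ⟨⟨x, b.elt * (weight c ξ)⁻¹⟩, le_iff.2 ⟨ξ, hξ, by simp⟩, rfl⟩

end Order

section Connectedness

theorem nonempty_edgePath_of_edgePath {x y : B} (ξ : EdgePath x y) (g : G) :
    Nonempty (EdgePath (⟨x, g⟩ : ColorSpace c) ⟨y, g * weight c ξ⟩) := by
  induction ξ generalizing g with
  | nil x => simpa [weight] using ⟨EdgePath.nil (⟨x, g⟩ : ColorSpace c)⟩
  | @up x y z hxy ξ ih =>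
    obtain ⟨η⟩ := ih (g * c x y hxy)
    rw [weight, ← mul_assoc]
    exact ⟨.up (covBy_iff_step.2 ⟨hxy, rfl⟩) η⟩
  | @down x y z hyx ξ ih =>
    obtain ⟨η⟩ := ih (g * (c y x hyx)⁻¹)
    rw [weight, ← mul_assoc]
    exact ⟨.down (covBy_iff_step.2 ⟨hyx, by simp⟩) η⟩

theorem nonempty_edgePath_iff {a b : ColorSpace c} : Nonempty (EdgePath a b) ↔
    ∃ ξ : EdgePath a.base b.base, b.elt = a.elt * weight c ξ := by
  refine ⟨?_, fun ⟨ξ, h⟩ => ?_⟩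
  · rintro ⟨η⟩
    induction η with
    | nil a => exact ⟨.nil a.base, by simp [weight]⟩
    | up hab _ ih =>
      obtain ⟨ξ, h⟩ := ih
      obtain ⟨hab, h'⟩ := covBy_iff_step.1 hab
      exact ⟨.up hab ξ, by rw [h, h', weight, mul_assoc]⟩
    | down hba _ ih =>
      obtain ⟨ξ, h⟩ := ih
      obtain ⟨hba, h'⟩ := covBy_iff_step.1 hba
      exact ⟨.down hba ξ, by rw [h, h', weight]; group⟩
  · have hb : b = ⟨b.base, a.elt * weight c ξ⟩ := ColorSpace.ext rfl h
    rw [hb]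
    exact nonempty_edgePath_of_edgePath ξ a.elt

instance : Topology.IsLowerSet (ColorSpace c) := ⟨rfl⟩

theorem connectedSpace_iff [TopologicalSpace B] [Topology.IsLowerSet B] [IsCovByGenerated B]
    [ConnectedSpace B] : ConnectedSpace (ColorSpace c) ↔ ConnectedColoring c := by
  obtain ⟨⟨x₀⟩, hB⟩ := connectedSpace_iff_edgePath.1 ‹ConnectedSpace B›
  rw [connectedSpace_iff_edgePath]
  refine ⟨fun h x g => ?_, fun h => ⟨⟨⟨x₀, 1⟩⟩, fun a b => ?_⟩⟩
  · obtain ⟨ξ, hξ⟩ := nonempty_edgePath_iff.1 (h.2 ⟨x, 1⟩ ⟨x, g⟩)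
    exact ⟨ξ, by simpa using hξ.symm⟩
  · obtain ⟨ξ⟩ := hB a.base b.base
    obtain ⟨η, hη⟩ := h a.base (a.elt⁻¹ * b.elt * (weight c ξ)⁻¹)
    exact nonempty_edgePath_iff.2 ⟨η.trans ξ, by simp [weight_trans, hη, mul_assoc]⟩

end Connectedness

theorem continuous_iff_step {X : Type*} [TopologicalSpace X] {f : ColorSpace c → X} :
    Continuous f ↔ ∀ a b, Step a b → f a ⤳ f b := by
  simp only [continuous_iff_specializes_of_covBy, covBy_iff_step]

section Action

instance : MulAction G (ColorSpace c) where
  smul g a := ⟨a.base, g * a.elt⟩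
  one_smul a := ColorSpace.ext rfl (one_mul a.elt)
  mul_smul g k a := ColorSpace.ext rfl (mul_assoc g k a.elt)

@[simp]
theorem smul_base (g : G) (a : ColorSpace c) : (g • a).base = a.base := rfl

@[simp]
theorem smul_elt (g : G) (a : ColorSpace c) : (g • a).elt = g * a.elt := rfl

theorem mem_orbit_iff {a b : ColorSpace c} : a ∈ MulAction.orbit G b ↔ a.base = b.base := by
  refine ⟨?_, fun h => ⟨a.elt * b.elt⁻¹, ColorSpace.ext h.symm (by simp)⟩⟩
  rintro ⟨g, rfl⟩
  rfl

theorem Step.smul {a b : ColorSpace c} (h : Step a b) (g : G) : Step (g • a) (g • b) := by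
  obtain ⟨hab, h⟩ := h
  exact ⟨hab, by simp [h, mul_assoc]⟩

instance : ContinuousConstSMul G (ColorSpace c) where
  continuous_const_smul g := continuous_iff_step.2 fun _ _ h =>
    Topology.IsLowerSet.specializes_iff_le.2 (h.smul g).le

variable [TopologicalSpace B] [Topology.IsLowerSet B]

theorem continuous_proj (c : Coloring B G) : Continuous (proj c) :=
  Topology.IsLowerSet.monotone_iff_continuous.1 (strictMono_proj c).monotone

variable [IsCovByGenerated B]

theorem isOpenMap_proj (c : Coloring B G) : IsOpenMap (proj c) := by
  intro U hU
  rw [Topology.IsLowerSet.isOpen_iff_isLowerSet] at hU ⊢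
  rintro _ x hx ⟨b, hb, rfl⟩
  obtain ⟨a, hab, rfl⟩ := exists_le_of_le_base hx
  exact ⟨a, hU hab hb, rfl⟩

theorem isQuotientCoveringMap_proj (hc : Admissible c) : IsQuotientCoveringMap (proj c) G where
  toIsQuotientMap := (isOpenMap_proj c).isQuotientMap (continuous_proj c) fun x => ⟨⟨x, 1⟩, rfl⟩
  toContinuousConstSMul := inferInstance
  apply_eq_iff_mem_orbit := mem_orbit_iff.symm
  disjoint e := by
    have hopen : IsOpen (Set.Iic e) :=
      Topology.IsLowerSet.isOpen_iff_isLowerSet.2 (isLowerSet_Iic e)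
    refine ⟨Set.Iic e, hopen.mem_nhds Set.self_mem_Iic, ?_⟩
    rintro g ⟨_, ⟨a, hae : a ≤ e, rfl⟩, hgae : g • a ≤ e⟩
    have hgae' : g • a ≤ g • e :=
      Topology.IsLowerSet.monotone_iff_continuous.2 (continuous_const_smul g) hae
    have heq : e = g • e := admissible_iff.1 hc (g • a) e (g • e) hgae hgae' rfl
    simpa using congrArg elt heq

end Action

end ColorSpace

section DeckTransformations

variable {X E E' : Type*} [TopologicalSpace E] [TopologicalSpace E'] {p : E → X} {p' : E' → X}

namespace Deck

instance : MulAction (Deck p) E where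
  smul d e := d.1 e
  one_smul _ := rfl
  mul_smul _ _ _ := rfl

instance : ContinuousConstSMul (Deck p) E := ⟨fun d => d.1.continuous⟩

/-- Conjugation of deck transformations by a homeomorphism over the base. -/
def congr (h : E ≃ₜ E') (hh : ∀ e, p' (h e) = p e) : Deck p ≃* Deck p' where
  toFun d := ⟨h.symm.trans (d.1.trans h), fun e => by
    simpa [hh, d.2 (h.symm e)] using (hh (h.symm e)).symm⟩
  invFun d := ⟨h.trans (d.1.trans h.symm), fun e => by
    simpa [d.2 (h e), hh e] using (hh (h.symm (d.1 (h e)))).symm⟩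
  left_inv d := Subtype.ext <| Homeomorph.ext fun e => by simp
  right_inv d := Subtype.ext <| Homeomorph.ext fun e => by simp
  map_mul' d d' := Subtype.ext <| Homeomorph.ext fun e => by simp

theorem congr_smul (h : E ≃ₜ E') (hh : ∀ e, p' (h e) = p e) (d : Deck p) (e : E) :
    congr h hh d • h e = h (d • e) :=
  congrArg (fun e => h (d.1 e)) (h.symm_apply_apply e)

theorem eq_of_smul_eq [TopologicalSpace X] [PreconnectedSpace E] (hp : IsCoveringMap p)
    {d d' : Deck p} (e : E) (h : d • e = d' • e) : d = d' :=
  Subtype.ext <| Homeomorph.ext <| congrFun <|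
    hp.eq_of_comp_eq d.1.continuous d'.1.continuous
      (funext fun a => (d.2 a).trans (d'.2 a).symm) e h

end Deck

variable [TopologicalSpace X]

theorem IsRegularCovering.isQuotientCoveringMap (hp : IsRegularCovering p) :
    IsQuotientCoveringMap p (Deck p) := by
  have := hp.connected
  refine (isQuotientCoveringMap_iff_isCoveringMap_and ..).2
    ⟨hp.isCoveringMap, hp.surjective, inferInstance, ?_, fun {e₁ e₂} => ⟨fun h => ?_, ?_⟩⟩
  · exact isCancelSMul_iff_eq_one_of_smul_eq.2 fun d e h =>
      Deck.eq_of_smul_eq hp.isCoveringMap e (h.trans (one_smul _ e).symm)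
  · obtain ⟨d, hd, h⟩ := hp.transitive e₂ e₁ h.symm
    exact ⟨⟨d, hd⟩, h⟩
  · rintro ⟨d, rfl⟩
    exact d.2 e₂

variable {G H : Type*} [Group G] [Group H]

theorem isQuotientCoveringMap_compHom [MulAction H E] (hp : IsQuotientCoveringMap p H)
    (θ : G ≃* H) :
    letI := MulAction.compHom E θ.toMonoidHom
    IsQuotientCoveringMap p G := by
  let _ := MulAction.compHom E θ.toMonoidHom
  exact
    { hp.toIsQuotientMap with
      continuous_const_smul g := hp.continuous_const_smul (θ g)
      apply_eq_iff_mem_orbit {e₁ e₂} := hp.apply_eq_iff_mem_orbit.trans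
        (θ.surjective.exists (p := fun k => k • e₂ = e₁))
      disjoint e := by
        obtain ⟨U, hU, hdisj⟩ := hp.disjoint e
        exact ⟨U, hU, fun g hg => (map_eq_one_iff θ θ.injective).1 (hdisj (θ g) hg)⟩ }

variable [MulAction G E]

theorem isRegularCovering_of_isQuotientCoveringMap [ConnectedSpace E]
    (hp : IsQuotientCoveringMap p G) : IsRegularCovering p where
  connected := inferInstance
  isCoveringMap := hp.isCoveringMap
  surjective := hp.surjective
  transitive e e' h := by
    have := hp.toContinuousConstSMul
    obtain ⟨g, hg⟩ := hp.apply_eq_iff_mem_orbit.1 h.symm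
    exact ⟨Homeomorph.smul g, fun _ => hp.map_smul g, hg⟩

namespace Deck

/-- The deck transformations by which `G` acts on a covering with quotient `X`. -/
def ofSMul (hp : IsQuotientCoveringMap p G) : G →* Deck p where
  toFun g := by
    have := hp.toContinuousConstSMul
    exact ⟨Homeomorph.smul g, fun _ => hp.map_smul g⟩
  map_one' := Subtype.ext <| Homeomorph.ext <| one_smul G
  map_mul' g k := Subtype.ext <| Homeomorph.ext <| mul_smul g k

theorem ofSMul_bijective [ConnectedSpace E] (hp : IsQuotientCoveringMap p G) :
    Function.Bijective (ofSMul hp) := by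
  obtain ⟨e⟩ := ‹ConnectedSpace E›.toNonempty
  have := hp.isCancelSMul
  refine ⟨fun g k h => ?_, fun d => ?_⟩
  · exact IsCancelSMul.right_cancel g k e (congrArg (fun d : Deck p => d • e) h)
  · obtain ⟨g, hg : g • e = d • e⟩ := hp.apply_eq_iff_mem_orbit.1 (d.2 e)
    exact ⟨g, eq_of_smul_eq hp.isCoveringMap e hg⟩

/-- The deck group of a connected covering which is the quotient by `G` is `G` itself. -/
noncomputable def equivOfSMul [ConnectedSpace E] (hp : IsQuotientCoveringMap p G) : G ≃* Deck p :=
  MulEquiv.ofBijective (ofSMul hp) (ofSMul_bijective hp)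

theorem equivOfSMul_smul [ConnectedSpace E] (hp : IsQuotientCoveringMap p G) (g : G) (e : E) :
    equivOfSMul hp g • e = g • e := rfl

end Deck

theorem exists_mulEquiv_map_smul [MulAction H E'] [ConnectedSpace E] [ConnectedSpace E']
    (hp : IsQuotientCoveringMap p G) (hp' : IsQuotientCoveringMap p' H)
    (h : E ≃ₜ E') (hh : ∀ e, p' (h e) = p e) :
    ∃ φ : G ≃* H, ∀ g e, h (g • e) = φ g • h e := by
  refine ⟨(Deck.equivOfSMul hp).trans ((Deck.congr h hh).trans (Deck.equivOfSMul hp').symm),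
    fun g e => ?_⟩
  rw [← Deck.equivOfSMul_smul hp, ← Deck.congr_smul h hh, ← Deck.equivOfSMul_smul hp']
  simp

theorem coveringEquiv_of_bijective (hp : IsLocalHomeomorph p) (hp' : IsLocalHomeomorph p')
    {f : E → E'} (hf : Continuous f) (hbij : Function.Bijective f) (hpf : ∀ e, p' (f e) = p e) :
    CoveringEquiv p p' := by
  obtain rfl : p' ∘ f = p := funext hpf
  have hloc : IsLocalHomeomorph f := hp.of_comp hp' hf
  exact ⟨hloc.toHomeomorphOfBijective hbij, hpf⟩

end DeckTransformations

section SpecializationLifting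

variable {X E : Type*} [TopologicalSpace E] {p : E → X}

theorem exists_specializes_of_isCoveringMap [TopologicalSpace X] (hp : IsCoveringMap p)
    {e : E} {y : X} (h : p e ⤳ y) : ∃ e', p e' = y ∧ e ⤳ e' := by
  obtain ⟨_, U, hyU, hU, -, H, hH⟩ := hp y
  have heU : p e ∈ U := h.mem_open hU hyU
  refine ⟨H.symm (⟨y, hyU⟩, (H ⟨e, heU⟩).2), by rw [← hH]; simp, ?_⟩
  have hbase : (H ⟨e, heU⟩).1 ⤳ ⟨y, hyU⟩ := (subtype_specializes_iff _ _).2 (by rwa [hH ⟨e, heU⟩])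
  have hprod : H ⟨e, heU⟩ ⤳ (⟨y, hyU⟩, (H ⟨e, heU⟩).2) :=
    specializes_prod.2 ⟨hbase, specializes_rfl⟩
  simpa using hprod.map (continuous_subtype_val.comp H.symm.continuous)

theorem eq_of_specializes_of_isSeparatedMap (hp : IsSeparatedMap p) {e e₁ e₂ : E} (h₁ : e ⤳ e₁)
    (h₂ : e ⤳ e₂) (h : p e₁ = p e₂) : e₁ = e₂ := by
  by_contra hne
  obtain ⟨U, V, hU, hV, heU, heV, hUV⟩ := hp e₁ e₂ h hne
  exact Set.disjoint_left.1 hUV (h₁.mem_open hU heU) (h₂.mem_open hV heV)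

end SpecializationLifting

section Equivalences

variable {B : Type*} [PartialOrder B] {G : Type*} [Group G] {c c' : Coloring B G}

/-- The bijections `E(c) → E(c')` over `B` that are semilinear along an automorphism `φ` of `G`;
`k x` is the image of `1` in the fiber over `x`. -/
@[simps]
def ColorSpace.twist (φ : G ≃* G) (k : B → G) : ColorSpace c ≃ ColorSpace c' where
  toFun a := ⟨a.base, φ a.elt * k a.base⟩
  invFun a := ⟨a.base, φ.symm (a.elt * (k a.base)⁻¹)⟩
  left_inv a := by simp
  right_inv a := by simp

theorem ColorSpace.step_twist_iff {φ : G ≃* G} {k : B → G}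
    (hk : ∀ x y (h : x ⋖ y), k x * c' x y h = φ (c x y h) * k y) {a b : ColorSpace c} :
    Step (twist φ k a : ColorSpace c') (twist φ k b) ↔ Step a b := by
  refine exists_congr fun h : a.base ⋖ b.base => ?_
  calc φ b.elt * k b.base = φ a.elt * k a.base * c' a.base b.base h
    _ ↔ φ b.elt * k b.base = φ (a.elt * c a.base b.base h) * k b.base := by
      rw [mul_assoc, hk, map_mul, mul_assoc]
    _ ↔ b.elt = a.elt * c a.base b.base h := by rw [mul_left_inj, φ.injective.eq_iff]

theorem ColorSpace.continuous_twist_iff {φ : G ≃* G} {k : B → G} :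
    Continuous (twist φ k : ColorSpace c → ColorSpace c') ↔
      ∀ x y (h : x ⋖ y), k x * c' x y h = φ (c x y h) * k y := by
  simp only [continuous_iff_step, Topology.IsLowerSet.specializes_iff_le]
  refine ⟨fun hmono x y h => ?_, fun hk a b hab => ((step_twist_iff hk).2 hab).le⟩
  have hle := hmono ⟨x, 1⟩ ⟨y, c x y h⟩ ⟨h, by simp⟩
  obtain ⟨_, helt⟩ := (le_iff_step_of_base_covBy h).1 hle
  simpa using helt.symm

theorem ColoringEquiv.coveringEquiv (h : ColoringEquiv c c') :
    CoveringEquiv (ColorSpace.proj c) (ColorSpace.proj c') := by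
  obtain ⟨φ, g, h⟩ := h
  let t : ColorSpace c ≃ ColorSpace c' := ColorSpace.twist φ fun x => φ (g x)⁻¹
  have hstep : ∀ {a b}, (t a).Step (t b) ↔ a.Step b :=
    ColorSpace.step_twist_iff fun x y hxy => by simp [h, mul_assoc]
  have hcont : Continuous t := ColorSpace.continuous_iff_step.2 fun a b hab =>
    Topology.IsLowerSet.specializes_iff_le.2 (hstep.2 hab).le
  have hcont_symm : Continuous t.symm := ColorSpace.continuous_iff_step.2 fun a b hab =>
    Topology.IsLowerSet.specializes_iff_le.2 (hstep.1 (by simpa using hab)).le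
  exact ⟨⟨t, hcont, hcont_symm⟩, fun _ => rfl⟩

variable [TopologicalSpace B] [Topology.IsLowerSet B] [IsCovByGenerated B]

theorem ACColoring.isQuotientCoveringMap (c : ACColoring B G) :
    IsQuotientCoveringMap (ColorSpace.proj c.1) G := ColorSpace.isQuotientCoveringMap_proj c.2.1

variable [ConnectedSpace B]

instance (c : ACColoring B G) : ConnectedSpace (ColorSpace c.1) :=
  ColorSpace.connectedSpace_iff.2 c.2.2

theorem coloringEquiv_iff_coveringEquiv (c c' : ACColoring B G) :
    ColoringEquiv c.1 c'.1 ↔ CoveringEquiv (ColorSpace.proj c.1) (ColorSpace.proj c'.1) := by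
  refine ⟨ColoringEquiv.coveringEquiv, fun ⟨h, hh⟩ => ?_⟩
  obtain ⟨φ, hφ⟩ := exists_mulEquiv_map_smul c.isQuotientCoveringMap c'.isQuotientCoveringMap h hh
  let k : B → G := fun x => (h ⟨x, 1⟩).elt
  have h_eq_twist : ⇑h = ColorSpace.twist φ k := funext fun ⟨x, g⟩ => by
    have hg : (⟨x, g⟩ : ColorSpace c.1) = g • ⟨x, 1⟩ := ColorSpace.ext rfl (mul_one g).symm
    rw [hg, hφ]
    exact ColorSpace.ext (hh ⟨x, 1⟩) (by simp [k])
  have hk := ColorSpace.continuous_twist_iff.1 (h_eq_twist ▸ h.continuous)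
  exact ⟨φ, fun x => φ.symm (k x)⁻¹, fun x y hxy => by simp [mul_assoc, ← hk]⟩

end Equivalences

section DevelopingMap

variable {B : Type*} [PartialOrder B] {E : Type*} [TopologicalSpace E] {G : Type*} [Group G]
  [MulAction G E] {c : Coloring B G} {p : E → B} {s : B → E}

/-- The equivariant map `E(c) → E` determined by a map `s` on the base, sending `(x, 1)` to
`s x`; it is meant for (not necessarily continuous) sections `s` of a covering. -/
def developingMap (c : Coloring B G) (s : B → E) (a : ColorSpace c) : E := a.elt • s a.base

theorem continuous_developingMap_iff [ContinuousConstSMul G E] :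
    Continuous (developingMap c s) ↔ ∀ x y (h : x ⋖ y), s x ⤳ (c x y h • s y) := by
  rw [ColorSpace.continuous_iff_step]
  refine ⟨fun hs x y h => ?_, fun hs => ?_⟩
  · simpa [developingMap] using hs ⟨x, 1⟩ ⟨y, c x y h⟩ ⟨h, by simp⟩
  · rintro a b ⟨h, hb⟩
    simpa only [developingMap, hb, mul_smul] using
      (hs _ _ h).map (continuous_const_smul a.elt)

variable [TopologicalSpace B] (hp : IsQuotientCoveringMap p G) (hs : Function.RightInverse s p)

include hp hs

theorem proj_developingMap (a : ColorSpace c) : p (developingMap c s a) = a.base :=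
  (hp.map_smul a.elt).trans (hs a.base)

theorem developingMap_bijective : Function.Bijective (developingMap c s) := by
  have := hp.isCancelSMul
  refine ⟨fun ⟨x, g⟩ ⟨y, k⟩ h => ?_, fun e => ?_⟩
  · obtain rfl : x = y := by simpa only [proj_developingMap hp hs] using congrArg p h
    exact ColorSpace.ext rfl (IsCancelSMul.right_cancel g k (s x) h)
  · obtain ⟨g, hg⟩ := hp.apply_eq_iff_mem_orbit.1 (hs (p e)).symm
    exact ⟨⟨p e, g⟩, hg⟩

theorem exists_continuous_developingMap [Topology.IsLowerSet B] :
    ∃ c : Coloring B G, Continuous (developingMap c s) := by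
  have := hp.toContinuousConstSMul
  have hlift : ∀ x y : B, x ⋖ y → ∃ g : G, s x ⤳ (g • s y) := fun x y hxy => by
    have hspec : p (s x) ⤳ y := by
      rw [hs x]
      exact Topology.IsLowerSet.specializes_iff_le.2 hxy.le
    obtain ⟨e, he, hse⟩ := exists_specializes_of_isCoveringMap hp.isCoveringMap hspec
    obtain ⟨g, rfl⟩ := hp.apply_eq_iff_mem_orbit.1 (he.trans (hs y).symm)
    exact ⟨g, hse⟩
  choose c hc using hlift
  exact ⟨c, continuous_developingMap_iff.2 hc⟩

theorem admissible_of_continuous_developingMap (hc : Continuous (developingMap c s)) :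
    Admissible c := by
  refine ColorSpace.admissible_iff.2 fun a b b' hb hb' hbase => ?_
  have hspec : ∀ {a b : ColorSpace c}, a ≤ b → developingMap c s a ⤳ developingMap c s b :=
    fun h => (Topology.IsLowerSet.specializes_iff_le.2 h).map hc
  refine (developingMap_bijective hp hs).injective
    (eq_of_specializes_of_isSeparatedMap hp.isCoveringMap.isSeparatedMap (hspec hb) (hspec hb') ?_)
  rwa [proj_developingMap hp hs, proj_developingMap hp hs]

end DevelopingMap

theorem exists_acColoring_coveringEquiv {B E G : Type*} [PartialOrder B] [TopologicalSpace B]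
    [Topology.IsLowerSet B] [IsCovByGenerated B] [TopologicalSpace E] [ConnectedSpace E] [Group G]
    [MulAction G E] {p : E → B} (hp : IsQuotientCoveringMap p G) :
    ∃ c : ACColoring B G, CoveringEquiv (ColorSpace.proj c.1) p := by
  have : ConnectedSpace B := hp.surjective.connectedSpace hp.continuous
  obtain ⟨s, hs⟩ := hp.surjective.hasRightInverse
  obtain ⟨c, hcont⟩ := exists_continuous_developingMap hp hs
  have hadm : Admissible c := admissible_of_continuous_developingMap hp hs hcont
  have hequiv : CoveringEquiv (ColorSpace.proj c) p := coveringEquiv_of_bijective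
    (ColorSpace.isQuotientCoveringMap_proj hadm).isCoveringMap.isLocalHomeomorph
    hp.isCoveringMap.isLocalHomeomorph hcont (developingMap_bijective hp hs)
    (proj_developingMap hp hs)
  have hconn : ConnectedSpace (ColorSpace c) :=
    let ⟨h, _⟩ := hequiv
    h.symm.surjective.connectedSpace h.symm.continuous
  exact ⟨⟨c, hadm, ColorSpace.connectedSpace_iff.1 hconn⟩, hequiv⟩

theorem RegularCovering.exists_acColoring {B : Type u} [PartialOrder B] [TopologicalSpace B]
    [Topology.IsLowerSet B] [IsCovByGenerated B] {G : Type v} [Group G]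
    (C : RegularCovering.{u, v, w} B G) :
    ∃ c : ACColoring B G, CoveringEquiv (ColorSpace.proj c.1) C.proj := by
  obtain ⟨θ⟩ := C.deck
  have := C.regular.connected
  let _ := MulAction.compHom C.total θ.symm.toMonoidHom
  exact exists_acColoring_coveringEquiv
    (isQuotientCoveringMap_compHom C.regular.isQuotientCoveringMap θ.symm)

end PosetColoring

open PosetColoring in
theorem theorem3p6_general {B : Type u} [PartialOrder B] [TopologicalSpace B]
    [Topology.IsLowerSet B] [ConnectedSpace B] [IsCovByGenerated B] {G : Type v} [Group G] :
    (∃ hreg : ∀ c : ACColoring B G,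
        IsRegularCovering (ColorSpace.proj c.1) ∧ Nonempty (Deck (ColorSpace.proj c.1) ≃* G),
      ∃ heq : ∀ c c' : ACColoring B G, c ≈ c' → coveringOf c.1 (hreg c) ≈ coveringOf c'.1 (hreg c'),
        Function.Bijective
          (Quotient.map (fun c : ACColoring B G => coveringOf c.1 (hreg c)) heq :
            Quotient (ACColoring.setoid (B := B) (G := G)) →
              Quotient (RegularCovering.setoid.{u, v, max u v} (B := B) G))) ∧
    ∀ C : RegularCovering.{u, v, w} B G, ∃ c : ACColoring B G,
      CoveringEquiv (ColorSpace.proj c.1) C.proj := by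
  refine ⟨⟨fun c => ⟨isRegularCovering_of_isQuotientCoveringMap c.isQuotientCoveringMap,
      ⟨(Deck.equivOfSMul c.isQuotientCoveringMap).symm⟩⟩,
    fun c c' => (coloringEquiv_iff_coveringEquiv c c').1, fun q q' => ?_, fun q => ?_⟩,
    RegularCovering.exists_acColoring⟩
  · induction q, q' using Quotient.inductionOn₂ with
    | h c c' =>
      exact fun h => Quotient.sound ((coloringEquiv_iff_coveringEquiv c c').2 (Quotient.exact h))
  · induction q using Quotient.inductionOn with
    | h C =>
      obtain ⟨c, hc⟩ := C.exists_acColoring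
      exact ⟨⟦c⟧, Quotient.sound hc⟩

theorem theorem3p6 {B : Type u} [PartialOrder B] [TopologicalSpace B] [Topology.IsLowerSet B]
    [ConnectedSpace B] (hB : PosetColoring.LocallyFinitePoset B) {G : Type v} [Group G] :
    -- for an admissible connected coloring, `p(c)` is a regular covering with deck group `G`
    (∃ hreg : ∀ c : PosetColoring.ACColoring B G,
        PosetColoring.IsRegularCovering (PosetColoring.ColorSpace.proj c.1) ∧
          Nonempty (PosetColoring.Deck (PosetColoring.ColorSpace.proj c.1) ≃* G),
      -- equivalent colorings give equivalent coverings
      ∃ heq : ∀ c c' : PosetColoring.ACColoring B G, c ≈ c' →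
          PosetColoring.coveringOf c.1 (hreg c) ≈ PosetColoring.coveringOf c'.1 (hreg c'),
        -- the induced map on equivalence classes is a bijection
        Function.Bijective
          (Quotient.map (fun c : PosetColoring.ACColoring B G =>
              PosetColoring.coveringOf c.1 (hreg c)) heq :
            Quotient (PosetColoring.ACColoring.setoid (B := B) (G := G)) →
              Quotient (PosetColoring.RegularCovering.setoid.{u, v, max u v} (B := B) G))) ∧
    -- and total spaces in any other universe give no further coverings
    (∀ C : PosetColoring.RegularCovering.{u, v, w} B G, ∃ c : PosetColoring.ACColoring B G,
      PosetColoring.CoveringEquiv (PosetColoring.ColorSpace.proj c.1) C.proj) := by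
  have := hB.isCovByGenerated
  exact theorem3p6_general
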